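/- For $q\in[-1,1]$ let $C(SU_q(2))$ be the universal unital $C^*$-algebra generated by $\alpha,\gamma$ subject to $$\alpha^*\alpha+\gamma^*\gamma=1,\quad \alpha\alpha^*+q^2\gamma\gamma^*=1,\quad \alpha\gamma=q\gamma\alpha,\quad \alpha\gamma^*=q\gamma^*\alpha,\quad \gamma\gamma^*=\gamma^*\gamma .$$ Identify $SU(2)$ with $\{(a,c)\in\mathbb C^2 : |a|^2+|c|^2=1\}$ via $(a,c)\mapsto\begin{pmatrix}a&-\bar c\\ c&\bar a\end{pmatrix}$, and write $\alpha,\gamma\in C(SU(2))$ also for the coordinate functions $\alpha(a,c)=a$, $\gamma(a,c)=c$. For $f\in C(SU(2))$ put $(f\cdot r)(a,c)=f(-a,c)$ and $(f\cdot s)(a,c)=f(a,-c)$. On $M_2(C(SU(2)))$ consider the maps $$\beta_1\begin{pmatrix}f&g\\h&k\end{pmatrix}=\begin{pmatrix}f\cdot s&-g\cdot s\\-h\cdot s&k\cdot s\end{pmatrix},\qquad \beta_2\begin{pmatrix}f&g\\h&k\end{pmatrix}=\begin{pmatrix}k\cdot r&h\cdot r\\g\cdot r&f\cdot r\end{pmatrix}.$$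 These are commuting $*$-automorphisms of order two, and so define an action $\beta$ of $\mathbb Z/2\oplus\mathbb Z/2$ on $M_2(C(SU(2)))$ in which the two canonical generators act by $\beta_1$ and $\beta_2$. **Theorem.** The unital $*$-homomorphism $\phi\colon C(SU_{-1}(2))\to M_2(C(SU(2)))$ determined, through the universal property, by $$\phi(\alpha)=\begin{pmatrix}\alpha&0\\0&-\alpha\end{pmatrix},\qquad \phi(\gamma)=\begin{pmatrix}0&\gamma\\\gamma&0\end{pmatrix}$$ is injective, and its image is exactly the fixed point algebra $\{x : \beta_g(x)=x \text{ for all } g\in\mathbb Z/2\oplus\mathbb Z/2\}$ of $\beta$. -/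

import Mathlib

noncomputable section

open scoped ComplexOrder

/-- A C⋆-seminorm on a complex ⋆-algebra. -/
structure CStarSeminorm (R : Type*) [Ring R] [StarRing R] [Algebra ℂ R] extends
    RingSeminorm R where
  smul' : ∀ (z : ℂ) (x : R), toFun (z • x) = ‖z‖ * toFun x
  star_mul_self' : ∀ x : R, toFun (star x * x) = toFun x ^ 2

namespace CStarSeminorm

section

variable {R : Type*} [Ring R] [StarRing R] [Algebra ℂ R]

instance : CoeFun (CStarSeminorm R) (fun _ => R → ℝ) := ⟨fun p => p.toFun⟩

theorem nonneg (p : CStarSeminorm R) (x : R) : 0 ≤ p x := apply_nonneg p.toRingSeminorm x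

theorem star_apply (p : CStarSeminorm R) (x : R) : p (star x) = p x := by
  have key : ∀ y : R, p y ≤ p (star y) := by
    intro y
    rcases (p.nonneg y).eq_or_lt with h | h
    · rw [← h]; exact p.nonneg _
    · have h1 : p y ^ 2 ≤ p (star y) * p y := by
        rw [← p.star_mul_self' y]; exact p.mul_le' _ _
      nlinarith
  refine le_antisymm ?_ (key x)
  simpa using key (star x)

/-- The algebra `R`, equipped with the seminorm `p`. -/
@[nolint unusedArguments]
def Normed (_p : CStarSeminorm R) : Type _ := R

instance (p : CStarSeminorm R) : SeminormedRing p.Normed :=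
  RingSeminorm.toSeminormedRing (R := R) p.toRingSeminorm

instance (p : CStarSeminorm R) : Algebra ℂ p.Normed := inferInstanceAs (Algebra ℂ R)

instance (p : CStarSeminorm R) : StarRing p.Normed := inferInstanceAs (StarRing R)

instance (p : CStarSeminorm R) [StarModule ℂ R] : StarModule ℂ p.Normed :=
  inferInstanceAs (StarModule ℂ R)

theorem norm_def (p : CStarSeminorm R) (x : p.Normed) : ‖x‖ = p x := rfl

instance (p : CStarSeminorm R) : NormedAlgebra ℂ p.Normed where
  norm_smul_le z x := (p.smul' z x).le

/-- The Hausdorff completion of `R` with respect to the C⋆-seminorm `p`. -/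
abbrev Completion (p : CStarSeminorm R) : Type _ := UniformSpace.Completion p.Normed

theorem isometry_star (p : CStarSeminorm R) : Isometry (star : p.Normed → p.Normed) :=
  AddMonoidHomClass.isometry_of_norm (starAddEquiv : p.Normed ≃+ p.Normed)
    (fun x => p.star_apply x)

/-- The involution of the completion is the continuous extension of the involution of `R`. -/
instance (p : CStarSeminorm R) : Star p.Completion where
  star := UniformSpace.Completion.map star

theorem coe_star (p : CStarSeminorm R) (x : p.Normed) :
    ((star x : p.Normed) : p.Completion) = star (x : p.Completion) :=
  (UniformSpace.Completion.map_coe p.isometry_star.uniformContinuous x).symm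

theorem continuous_star (p : CStarSeminorm R) :
    Continuous (star : p.Completion → p.Completion) :=
  UniformSpace.Completion.continuous_map

instance (p : CStarSeminorm R) : StarRing p.Completion where
  star_involutive x := by
    induction x using UniformSpace.Completion.induction_on with
    | hp => exact isClosed_eq (p.continuous_star.comp p.continuous_star) continuous_id
    | ih x => rw [← coe_star, ← coe_star, star_star]
  star_mul x y := by
    induction x, y using UniformSpace.Completion.induction_on₂ with
    | hp =>
      exact isClosed_eq (p.continuous_star.comp (continuous_fst.mul continuous_snd))
        ((p.continuous_star.comp continuous_snd).mul (p.continuous_star.comp continuous_fst))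
    | ih x y =>
      rw [← UniformSpace.Completion.coe_mul, ← coe_star, star_mul,
        UniformSpace.Completion.coe_mul, coe_star, coe_star]
  star_add x y := by
    induction x, y using UniformSpace.Completion.induction_on₂ with
    | hp =>
      exact isClosed_eq (p.continuous_star.comp (continuous_fst.add continuous_snd))
        ((p.continuous_star.comp continuous_fst).add (p.continuous_star.comp continuous_snd))
    | ih x y =>
      rw [← UniformSpace.Completion.coe_add, ← coe_star, star_add,
        UniformSpace.Completion.coe_add, coe_star, coe_star]

instance (p : CStarSeminorm R) : NormedAlgebra ℂ p.Completion where
  norm_smul_le := norm_smul_le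

instance (p : CStarSeminorm R) [StarModule ℂ R] : StarModule ℂ p.Completion where
  star_smul z x := by
    induction x using UniformSpace.Completion.induction_on with
    | hp =>
      exact isClosed_eq (p.continuous_star.comp (continuous_const_smul z))
        ((continuous_const_smul (star z)).comp p.continuous_star)
    | ih x =>
      rw [← UniformSpace.Completion.coe_smul, ← coe_star, star_smul,
        UniformSpace.Completion.coe_smul, coe_star]

instance (p : CStarSeminorm R) : CStarRing p.Completion where
  norm_mul_self_le x := by
    induction x using UniformSpace.Completion.induction_on with
    | hp =>
      exact isClosed_le (continuous_norm.mul continuous_norm)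
        (continuous_norm.comp (p.continuous_star.mul continuous_id))
    | ih x =>
      rw [← coe_star, ← UniformSpace.Completion.coe_mul, UniformSpace.Completion.norm_coe,
        UniformSpace.Completion.norm_coe, ← sq]
      exact (p.star_mul_self' x).ge

instance (p : CStarSeminorm R) [StarModule ℂ R] : CStarAlgebra p.Completion where

/-- The canonical ⋆-homomorphism from `R` to its completion; it has dense range. -/
def toCompletion (p : CStarSeminorm R) : R →⋆ₐ[ℂ] p.Completion where
  toFun x := ((show p.Normed from x) : p.Completion)
  map_one' := rfl
  map_mul' x y := UniformSpace.Completion.coe_mul (α := p.Normed) x y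
  map_zero' := rfl
  map_add' x y := UniformSpace.Completion.coe_add (α := p.Normed) x y
  commutes' _ := rfl
  map_star' x := p.coe_star x

theorem norm_toCompletion (p : CStarSeminorm R) (x : R) : ‖p.toCompletion x‖ = p x :=
  UniformSpace.Completion.norm_coe (E := p.Normed) x

theorem denseRange_toCompletion (p : CStarSeminorm R) : DenseRange p.toCompletion :=
  UniformSpace.Completion.denseRange_coe (α := p.Normed)

/-- A ⋆-homomorphism on `R`, regarded as a ring homomorphism on the seminormed copy of `R`. -/
def normedHom (p : CStarSeminorm R) {B : Type*} [CStarAlgebra B] (f : R →⋆ₐ[ℂ] B) :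
    p.Normed →+* B where
  toFun x := f x
  map_one' := map_one f
  map_mul' := map_mul f
  map_zero' := map_zero f
  map_add' := map_add f

theorem continuous_normedHom (p : CStarSeminorm R) {B : Type*} [CStarAlgebra B]
    (f : R →⋆ₐ[ℂ] B) (hf : ∀ x, ‖f x‖ ≤ p x) : Continuous (p.normedHom f) :=
  AddMonoidHomClass.continuous_of_bound (p.normedHom f) 1
    (fun x => by rw [one_mul]; exact hf x)

/-- A ⋆-homomorphism into a C⋆-algebra that is bounded by `p` extends to the completion. -/
def liftCompletion (p : CStarSeminorm R) {B : Type*} [CStarAlgebra B] (f : R →⋆ₐ[ℂ] B)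
    (hf : ∀ x, ‖f x‖ ≤ p x) : p.Completion →⋆ₐ[ℂ] B where
  toRingHom := UniformSpace.Completion.extensionHom (p.normedHom f) (p.continuous_normedHom f hf)
  commutes' z :=
    (UniformSpace.Completion.extensionHom_coe (p.normedHom f) (p.continuous_normedHom f hf)
      (algebraMap ℂ p.Normed z)).trans (AlgHomClass.commutes f z)
  map_star' x := by
    have hcont : Continuous (UniformSpace.Completion.extensionHom (p.normedHom f)
        (p.continuous_normedHom f hf)) := UniformSpace.Completion.continuous_extension
    change UniformSpace.Completion.extensionHom (p.normedHom f) (p.continuous_normedHom f hf)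
        (star x) = star (UniformSpace.Completion.extensionHom (p.normedHom f)
          (p.continuous_normedHom f hf) x)
    induction x using UniformSpace.Completion.induction_on with
    | hp => exact isClosed_eq (hcont.comp p.continuous_star) (hcont.star)
    | ih x =>
      rw [← coe_star, UniformSpace.Completion.extensionHom_coe,
        UniformSpace.Completion.extensionHom_coe]
      exact map_star f x

theorem liftCompletion_toCompletion (p : CStarSeminorm R) {B : Type*} [CStarAlgebra B]
    (f : R →⋆ₐ[ℂ] B) (hf : ∀ x, ‖f x‖ ≤ p x) (x : R) :
    p.liftCompletion f hf (p.toCompletion x) = f x :=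
  UniformSpace.Completion.extensionHom_coe (p.normedHom f) (p.continuous_normedHom f hf) x

/-- The C⋆-seminorm `x ↦ ‖f x‖` induced by a ⋆-homomorphism `f` into a C⋆-algebra. -/
def ofStarAlgHom {B : Type*} [CStarAlgebra B] (f : R →⋆ₐ[ℂ] B) : CStarSeminorm R where
  toFun x := ‖f x‖
  map_zero' := by simp
  add_le' x y := by rw [map_add]; exact norm_add_le _ _
  neg' x := by rw [map_neg, norm_neg]
  mul_le' x y := by rw [map_mul]; exact norm_mul_le _ _
  smul' z x := by rw [map_smul, norm_smul]
  star_mul_self' x := by rw [map_mul, map_star, CStarRing.norm_star_mul_self, sq]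

/-- The pointwise supremum of a pointwise bounded set of C⋆-seminorms. -/
def sup (S : Set (CStarSeminorm R)) (hS : ∀ x, ∃ C, ∀ p ∈ S, p x ≤ C) : CStarSeminorm R :=
  have le : ∀ (p : S) (x : R), p.1 x ≤ ⨆ p : S, p.1 x := fun p x =>
    le_ciSup (f := fun p : S => p.1 x)
      ((hS x).imp fun _ hC => by rintro _ ⟨p, rfl⟩; exact hC p.1 p.2) p
  have nn : ∀ x : R, 0 ≤ ⨆ p : S, p.1 x := fun x => Real.iSup_nonneg fun p => p.1.nonneg x
  { toFun := fun x => ⨆ p : S, p.1 x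
    map_zero' := by simp [fun p : CStarSeminorm R => p.map_zero']
    add_le' := fun x y => Real.iSup_le
      (fun p => (p.1.add_le' x y).trans (add_le_add (le p x) (le p y))) (add_nonneg (nn x) (nn y))
    neg' := fun x => iSup_congr fun p => p.1.neg' x
    mul_le' := fun x y => Real.iSup_le
      (fun p => (p.1.mul_le' x y).trans (mul_le_mul (le p x) (le p y) (p.1.nonneg y) (nn x)))
      (mul_nonneg (nn x) (nn y))
    smul' := fun z x => by
      simp only [fun p : CStarSeminorm R => p.smul']
      exact (Real.mul_iSup_of_nonneg (norm_nonneg z) _).symm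
    star_mul_self' := fun x => by
      simp only [fun p : CStarSeminorm R => p.star_mul_self']
      refine le_antisymm (Real.iSup_le
        (fun p => pow_le_pow_left₀ (p.1.nonneg x) (le p x) 2) (sq_nonneg _)) ?_
      have hb : BddAbove (Set.range fun p : S => p.1 x ^ 2) := by
        obtain ⟨C, hC⟩ := hS x
        refine ⟨C ^ 2, ?_⟩
        rintro _ ⟨p, rfl⟩
        exact pow_le_pow_left₀ (p.1.nonneg x) (hC p.1 p.2) 2
      have hn : 0 ≤ ⨆ p : S, p.1 x ^ 2 := Real.iSup_nonneg fun p => sq_nonneg _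
      rw [← Real.le_sqrt (nn x) hn]
      exact Real.iSup_le (fun p => Real.le_sqrt_of_sq_le (le_ciSup hb p)) (Real.sqrt_nonneg _) }

theorem le_sup (S : Set (CStarSeminorm R)) (hS : ∀ x, ∃ C, ∀ p ∈ S, p x ≤ C)
    (p : CStarSeminorm R) (hp : p ∈ S) (x : R) : p x ≤ sup S hS x :=
  le_ciSup (f := fun p : S => p.1 x)
    ((hS x).imp fun _ hC => by rintro _ ⟨p, rfl⟩; exact hC p.1 p.2) ⟨p, hp⟩

theorem sup_le (S : Set (CStarSeminorm R)) (hS : ∀ x, ∃ C, ∀ p ∈ S, p x ≤ C)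
    (x : R) (C : ℝ) (hC : 0 ≤ C) (h : ∀ p ∈ S, p x ≤ C) : sup S hS x ≤ C :=
  Real.iSup_le (fun p => h p.1 p.2) hC

end

end CStarSeminorm

/-- The free complex unital ⋆-algebra on a set `X` of generators: noncommutative polynomials in
the letters `x` (`Sum.inl x`) and their formal adjoints `x⋆` (`Sum.inr x`). -/
def FreeStarAlgebra (X : Type*) : Type _ := FreeAlgebra ℂ (X ⊕ X)

namespace FreeStarAlgebra

variable {X : Type*}

instance : Ring (FreeStarAlgebra X) := inferInstanceAs (Ring (FreeAlgebra ℂ (X ⊕ X)))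

instance : Algebra ℂ (FreeStarAlgebra X) := inferInstanceAs (Algebra ℂ (FreeAlgebra ℂ (X ⊕ X)))

/-- A letter of the alphabet `X ⊕ X`. -/
def letter (s : X ⊕ X) : FreeStarAlgebra X := FreeAlgebra.ι ℂ s

/-- The generator `x`. -/
def gen (x : X) : FreeStarAlgebra X := letter (Sum.inl x)

/-- The universal property of the underlying free algebra. -/
def liftAlg {B : Type*} [Ring B] [Algebra ℂ B] (f : X ⊕ X → B) : FreeStarAlgebra X →ₐ[ℂ] B :=
  FreeAlgebra.lift ℂ f

theorem liftAlg_letter {B : Type*} [Ring B] [Algebra ℂ B] (f : X ⊕ X → B) (s : X ⊕ X) :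
    liftAlg f (letter s) = f s := FreeAlgebra.lift_ι_apply f s

theorem induction {C : FreeStarAlgebra X → Prop}
    (h_scalar : ∀ z : ℂ, C (algebraMap ℂ (FreeStarAlgebra X) z))
    (h_letter : ∀ s, C (letter s)) (h_mul : ∀ x y, C x → C y → C (x * y))
    (h_add : ∀ x y, C x → C y → C (x + y)) (x : FreeStarAlgebra X) : C x :=
  FreeAlgebra.induction ℂ (X ⊕ X) (motive := C) h_scalar h_letter
    (fun x y => h_mul x y) (fun x y => h_add x y) x

/-- The conjugate-linear antihomomorphism exchanging `x` and `x⋆`, as a ring homomorphism into the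
opposite ring (which is made a `ℂ`-algebra through complex conjugation). -/
def starAux : FreeStarAlgebra X →+* (FreeStarAlgebra X)ᵐᵒᵖ :=
  letI : Algebra ℂ (FreeStarAlgebra X)ᵐᵒᵖ :=
    Algebra.compHom (FreeStarAlgebra X)ᵐᵒᵖ (starRingEnd ℂ)
  (liftAlg (fun s : X ⊕ X => MulOpposite.op (letter s.swap))).toRingHom

theorem starAux_letter (s : X ⊕ X) :
    starAux (letter s) = MulOpposite.op (letter s.swap) :=
  letI : Algebra ℂ (FreeStarAlgebra X)ᵐᵒᵖ :=
    Algebra.compHom (FreeStarAlgebra X)ᵐᵒᵖ (starRingEnd ℂ)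
  liftAlg_letter (fun s : X ⊕ X => MulOpposite.op (letter s.swap)) s

theorem starAux_algebraMap (z : ℂ) : starAux (algebraMap ℂ (FreeStarAlgebra X) z) =
    MulOpposite.op (algebraMap ℂ (FreeStarAlgebra X) (star z)) :=
  letI : Algebra ℂ (FreeStarAlgebra X)ᵐᵒᵖ :=
    Algebra.compHom (FreeStarAlgebra X)ᵐᵒᵖ (starRingEnd ℂ)
  (liftAlg (fun s : X ⊕ X => MulOpposite.op (letter s.swap))).commutes z

/-- The involution: the conjugate-linear antiautomorphism exchanging `x` and `x⋆`. -/
instance : StarRing (FreeStarAlgebra X) where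
  star x := (starAux x).unop
  star_involutive x := by
    induction x using induction with
    | h_scalar z => simp [starAux_algebraMap]
    | h_letter s => simp [starAux_letter]
    | h_mul x y hx hy => simp only [map_mul, MulOpposite.unop_mul, hx, hy]
    | h_add x y hx hy => simp only [map_add, MulOpposite.unop_add, hx, hy]
  star_mul x y := by simp only [map_mul, MulOpposite.unop_mul]
  star_add x y := by simp only [map_add, MulOpposite.unop_add]

theorem star_letter (s : X ⊕ X) : star (letter s) = letter s.swap :=
  congrArg MulOpposite.unop (starAux_letter s)

theorem star_algebraMap (z : ℂ) : star (algebraMap ℂ (FreeStarAlgebra X) z) =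
    algebraMap ℂ (FreeStarAlgebra X) (star z) :=
  congrArg MulOpposite.unop (starAux_algebraMap z)

instance : StarModule ℂ (FreeStarAlgebra X) where
  star_smul z x := by
    rw [Algebra.smul_def, star_mul, star_algebraMap, Algebra.smul_def, Algebra.commutes]

/-- The ⋆-homomorphism sending each generator `x` to `f x`. -/
def lift {B : Type*} [Ring B] [StarRing B] [Algebra ℂ B] [StarModule ℂ B] (f : X → B) :
    FreeStarAlgebra X →⋆ₐ[ℂ] B where
  toAlgHom := liftAlg (Sum.elim f (fun x => star (f x)))
  map_star' x := by
    change liftAlg _ (star x) = star (liftAlg _ x)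
    induction x using induction with
    | h_scalar z => rw [star_algebraMap, AlgHom.commutes, AlgHom.commutes, algebraMap_star_comm]
    | h_letter s => cases s <;> simp [star_letter, liftAlg_letter]
    | h_mul x y hx hy => rw [star_mul, map_mul, map_mul, hx, hy, star_mul]
    | h_add x y hx hy => rw [star_add, map_add, map_add, hx, hy, star_add]

theorem lift_gen {B : Type*} [Ring B] [StarRing B] [Algebra ℂ B] [StarModule ℂ B] (f : X → B)
    (x : X) : lift f (gen x) = f x :=
  liftAlg_letter _ _

theorem hom_ext {B : Type*} [Ring B] [StarRing B] [Algebra ℂ B]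
    {φ ψ : FreeStarAlgebra X →⋆ₐ[ℂ] B} (h : ∀ x, φ (gen x) = ψ (gen x)) : φ = ψ := by
  ext x
  induction x using induction with
  | h_scalar z => rw [AlgHomClass.commutes, AlgHomClass.commutes]
  | h_letter s =>
    rcases s with x | x
    · exact h x
    · have : (letter (Sum.inr x) : FreeStarAlgebra X) = star (gen x) :=
        (star_letter (Sum.inl x)).symm
      rw [this, map_star, map_star, h]
  | h_mul x y hx hy => rw [map_mul, map_mul, hx, hy]
  | h_add x y hx hy => rw [map_add, map_add, hx, hy]

end FreeStarAlgebra

/-- The pair `(a, c)` satisfies the defining relations of `C(SU_q(2))`. -/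
structure IsSUqPair (q : ℝ) {B : Type*} [Ring B] [StarRing B] [Algebra ℂ B] (a c : B) : Prop where
  star_a_mul_a : star a * a + star c * c = 1
  a_mul_star_a : a * star a + ((q : ℂ) ^ 2) • (c * star c) = 1
  a_mul_c : a * c = (q : ℂ) • (c * a)
  a_mul_star_c : a * star c = (q : ℂ) • (star c * a)
  c_mul_star_c : c * star c = star c * c

theorem IsSUqPair.norm_le_one {q : ℝ} {B : Type*} [CStarAlgebra B] {a c : B}
    (h : IsSUqPair q a c) : ‖a‖ ≤ 1 ∧ ‖c‖ ≤ 1 := by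
  let := CStarAlgebra.spectralOrder B
  let := CStarAlgebra.spectralOrderedRing B
  have key : ∀ x y : B, star x * x + star y * y = 1 → ‖x‖ ≤ 1 := by
    intro x y hxy
    have h1 : star x * x ≤ 1 := by
      rw [← hxy]; exact le_add_of_nonneg_right (star_mul_self_nonneg y)
    have h2 := (CStarAlgebra.norm_le_one_iff_of_nonneg (star x * x)).2 h1
    rw [CStarRing.norm_star_mul_self] at h2
    nlinarith [norm_nonneg x]
  exact ⟨key a c h.star_a_mul_a, key c a (by rw [add_comm]; exact h.star_a_mul_a)⟩

theorem IsSUqPair.map {q : ℝ} {B C : Type*} [Ring B] [StarRing B] [Algebra ℂ B]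
    [Ring C] [StarRing C] [Algebra ℂ C] {a c : B} (h : IsSUqPair q a c) (f : B →⋆ₐ[ℂ] C) :
    IsSUqPair q (f a) (f c) where
  star_a_mul_a := by
    rw [← map_star, ← map_star, ← map_mul, ← map_mul, ← map_add, h.star_a_mul_a, map_one]
  a_mul_star_a := by
    rw [← map_star, ← map_star, ← map_mul, ← map_mul, ← map_smul, ← map_add, h.a_mul_star_a,
      map_one]
  a_mul_c := by rw [← map_mul, h.a_mul_c, map_smul, map_mul]
  a_mul_star_c := by rw [← map_star, ← map_mul, h.a_mul_star_c, map_smul, map_mul]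
  c_mul_star_c := by rw [← map_star, ← map_mul, h.c_mul_star_c, map_mul]

/-- The relations can be tested after any ⋆-homomorphism that separates points on them. -/
theorem IsSUqPair.of_map {q : ℝ} {A B C : Type*} [Ring A] [StarRing A] [Algebra ℂ A]
    [Ring B] [StarRing B] [Algebra ℂ B]
    [Ring C] [StarRing C] [Algebra ℂ C] {a c : A} (f : A →⋆ₐ[ℂ] B) (g : A →⋆ₐ[ℂ] C)
    (hfg : ∀ x y, f x = f y → g x = g y) (h : IsSUqPair q (f a) (f c)) :
    IsSUqPair q (g a) (g c) where
  star_a_mul_a := by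
    simpa only [map_add, map_mul, map_star, map_smul, map_one] using hfg (star a * a + star c * c) 1 (by simpa only [map_add, map_mul, map_star, map_smul, map_one] using h.star_a_mul_a)
  a_mul_star_a := by
    simpa only [map_add, map_mul, map_star, map_smul, map_one] using hfg (a * star a + ((q : ℂ) ^ 2) • (c * star c)) 1 (by simpa only [map_add, map_mul, map_star, map_smul, map_one] using h.a_mul_star_a)
  a_mul_c := by
    simpa only [map_add, map_mul, map_star, map_smul, map_one] using hfg (a * c) ((q : ℂ) • (c * a)) (by simpa only [map_add, map_mul, map_star, map_smul, map_one] using h.a_mul_c)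
  a_mul_star_c := by
    simpa only [map_add, map_mul, map_star, map_smul, map_one] using hfg (a * star c) ((q : ℂ) • (star c * a)) (by simpa only [map_add, map_mul, map_star, map_smul, map_one] using h.a_mul_star_c)
  c_mul_star_c := by
    simpa only [map_add, map_mul, map_star, map_smul, map_one] using hfg (c * star c) (star c * c) (by simpa only [map_add, map_mul, map_star, map_smul, map_one] using h.c_mul_star_c)

namespace SUq

/-- The free ⋆-algebra on the two generators `α = gen 0` and `γ = gen 1`. -/
abbrev Free : Type := FreeStarAlgebra (Fin 2)

/-- The C⋆-seminorms on the free ⋆-algebra on `α`, `γ` for which the defining relations of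
`C(SU_q(2))` hold in the completion. -/
def admissible (q : ℝ) : Set (CStarSeminorm Free) :=
  {p | IsSUqPair q (p.toCompletion (FreeStarAlgebra.gen 0))
    (p.toCompletion (FreeStarAlgebra.gen 1))}

theorem admissible_bounded (q : ℝ) (x : Free) : ∃ C, ∀ p ∈ admissible q, p x ≤ C := by
  have nn : ∀ (p : CStarSeminorm Free) x, 0 ≤ p x := fun p x => p.nonneg x
  have hgen : ∀ i : Fin 2, ∀ p ∈ admissible q, p (FreeStarAlgebra.gen i) ≤ 1 := by
    intro i p hp
    have h := IsSUqPair.norm_le_one hp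
    rw [p.norm_toCompletion, p.norm_toCompletion] at h
    fin_cases i
    · exact h.1
    · exact h.2
  induction x using FreeStarAlgebra.induction with
  | h_scalar z =>
    refine ⟨‖z‖, fun p _ => ?_⟩
    have h1 : p (1 : Free) ≤ 1 := by
      have := p.star_mul_self' 1
      rw [star_one, one_mul] at this
      by_contra hlt
      push Not at hlt
      nlinarith
    rw [Algebra.algebraMap_eq_smul_one]
    refine (p.smul' z 1).le.trans ?_
    exact mul_le_of_le_one_right (norm_nonneg z) h1
  | h_letter s =>
    refine ⟨1, fun p hp => ?_⟩
    rcases s with i | i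
    · exact hgen i p hp
    · have : (FreeStarAlgebra.letter (Sum.inr i) : Free) = star (FreeStarAlgebra.gen i) :=
        (FreeStarAlgebra.star_letter (Sum.inl i)).symm
      rw [this, p.star_apply]
      exact hgen i p hp
  | h_mul x y hx hy =>
    obtain ⟨C, hC⟩ := hx
    obtain ⟨D, hD⟩ := hy
    refine ⟨C * D, fun p hp => (p.mul_le' x y).trans ?_⟩
    exact mul_le_mul (hC p hp) (hD p hp) (nn p y) ((nn p x).trans (hC p hp))
  | h_add x y hx hy =>
    obtain ⟨C, hC⟩ := hx
    obtain ⟨D, hD⟩ := hy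
    exact ⟨C + D, fun p hp => (p.add_le' x y).trans (add_le_add (hC p hp) (hD p hp))⟩

/-- The largest C⋆-seminorm compatible with the relations. -/
def universalSeminorm (q : ℝ) : CStarSeminorm Free :=
  CStarSeminorm.sup (admissible q) (admissible_bounded q)

end SUq

/-- `C(SU_q(2))`: the universal unital C⋆-algebra on two generators `α`, `γ` subject to the
relations `IsSUqPair q α γ`, constructed as the completion of the free ⋆-algebra in the largest
C⋆-seminorm compatible with the relations. -/
def CSUq (q : ℝ) : Type := (SUq.universalSeminorm q).Completion

instance (q : ℝ) : CStarAlgebra (CSUq q) :=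
  inferInstanceAs (CStarAlgebra (SUq.universalSeminorm q).Completion)

namespace CSUq

/-- The canonical ⋆-homomorphism from the free ⋆-algebra; it has dense range. -/
def ofFree (q : ℝ) : SUq.Free →⋆ₐ[ℂ] CSUq q := (SUq.universalSeminorm q).toCompletion

theorem norm_ofFree (q : ℝ) (x : SUq.Free) : ‖ofFree q x‖ = SUq.universalSeminorm q x :=
  CStarSeminorm.norm_toCompletion _ x

theorem denseRange_ofFree (q : ℝ) : DenseRange (ofFree q) :=
  CStarSeminorm.denseRange_toCompletion _

/-- The generator `α`. -/
def α (q : ℝ) : CSUq q := ofFree q (FreeStarAlgebra.gen 0)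

/-- The generator `γ`. -/
def γ (q : ℝ) : CSUq q := ofFree q (FreeStarAlgebra.gen 1)

theorem isSUqPair (q : ℝ) : IsSUqPair q (α q) (γ q) := by
  have key : ∀ x y : SUq.Free, (∀ p ∈ SUq.admissible q, p.toCompletion x = p.toCompletion y) →
      ofFree q x = ofFree q y := by
    intro x y h
    rw [← sub_eq_zero, ← map_sub, ← norm_eq_zero, norm_ofFree]
    refine le_antisymm (CStarSeminorm.sup_le _ _ _ _ le_rfl fun p hp => ?_)
      (CStarSeminorm.nonneg _ _)
    rw [← p.norm_toCompletion, map_sub, h p hp, sub_self, norm_zero]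
  unfold α γ
  set a : SUq.Free := FreeStarAlgebra.gen 0
  set c : SUq.Free := FreeStarAlgebra.gen 1
  refine ⟨?_, ?_, ?_, ?_, ?_⟩
  · simpa only [map_add, map_mul, map_star, map_smul, map_one] using key (star a * a + star c * c) 1 fun p hp => by simpa only [map_add, map_mul, map_star, map_smul, map_one] using hp.star_a_mul_a
  · simpa only [map_add, map_mul, map_star, map_smul, map_one] using key (a * star a + ((q : ℂ) ^ 2) • (c * star c)) 1
      fun p hp => by simpa only [map_add, map_mul, map_star, map_smul, map_one] using hp.a_mul_star_a
  · simpa only [map_add, map_mul, map_star, map_smul, map_one] using key (a * c) ((q : ℂ) • (c * a)) fun p hp => by simpa only [map_add, map_mul, map_star, map_smul, map_one] using hp.a_mul_c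
  · simpa only [map_add, map_mul, map_star, map_smul, map_one] using key (a * star c) ((q : ℂ) • (star c * a))
      fun p hp => by simpa only [map_add, map_mul, map_star, map_smul, map_one] using hp.a_mul_star_c
  · simpa only [map_add, map_mul, map_star, map_smul, map_one] using key (c * star c) (star c * c) fun p hp => by simpa only [map_add, map_mul, map_star, map_smul, map_one] using hp.c_mul_star_c

section UniversalProperty

variable {q : ℝ} {B : Type*} [CStarAlgebra B] {a c : B}

theorem norm_lift_le (h : IsSUqPair q a c) (x : SUq.Free) :
    ‖FreeStarAlgebra.lift ![a, c] x‖ ≤ SUq.universalSeminorm q x := by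
  refine CStarSeminorm.le_sup (SUq.admissible q) (SUq.admissible_bounded q)
    (CStarSeminorm.ofStarAlgHom (FreeStarAlgebra.lift ![a, c])) ?_ x
  refine IsSUqPair.of_map (FreeStarAlgebra.lift ![a, c]) _ ?_ ?_
  · intro x y hxy
    rw [← sub_eq_zero, ← map_sub, ← norm_eq_zero, CStarSeminorm.norm_toCompletion]
    change ‖FreeStarAlgebra.lift ![a, c] (x - y)‖ = 0
    rw [map_sub, hxy, sub_self, norm_zero]
  · simpa [FreeStarAlgebra.lift_gen] using h

/-- The universal property of `C(SU_q(2))`: a pair `(a, c)` in a unital C⋆-algebra satisfying the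
relations determines a unital ⋆-homomorphism with `α ↦ a` and `γ ↦ c`. -/
def lift (h : IsSUqPair q a c) : CSUq q →⋆ₐ[ℂ] B :=
  (SUq.universalSeminorm q).liftCompletion (FreeStarAlgebra.lift ![a, c]) (norm_lift_le h)

theorem lift_α (h : IsSUqPair q a c) : lift h (α q) = a :=
  ((SUq.universalSeminorm q).liftCompletion_toCompletion _ (norm_lift_le h) _).trans
    (FreeStarAlgebra.lift_gen _ _)

theorem lift_γ (h : IsSUqPair q a c) : lift h (γ q) = c :=
  ((SUq.universalSeminorm q).liftCompletion_toCompletion _ (norm_lift_le h) _).trans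
    (FreeStarAlgebra.lift_gen _ _)

open scoped CStarAlgebra in
/-- Uniqueness in the universal property. -/
theorem hom_ext {φ ψ : CSUq q →⋆ₐ[ℂ] B} (hα : φ (α q) = ψ (α q)) (hγ : φ (γ q) = ψ (γ q)) :
    φ = ψ := by
  have h : φ.comp (ofFree q) = ψ.comp (ofFree q) := by
    refine FreeStarAlgebra.hom_ext fun i => ?_
    fin_cases i
    · exact hα
    · exact hγ
  have hφ : Continuous φ := map_continuous φ
  have hψ : Continuous ψ := map_continuous ψ
  refine DFunLike.coe_injective ((denseRange_ofFree q).equalizer hφ hψ ?_)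
  exact funext fun x => DFunLike.congr_fun h x

end UniversalProperty

end CSUq

/-- The space `SU(2)`, identified with the sphere `{(a, c) ∈ ℂ² : |a|² + |c|² = 1}` through
`(a, c) ↦ !![a, -conj c; c, conj a]`. -/
def SU2 : Type := {p : ℂ × ℂ // ‖p.1‖ ^ 2 + ‖p.2‖ ^ 2 = 1}

namespace SU2

instance : TopologicalSpace SU2 :=
  inferInstanceAs (TopologicalSpace {p : ℂ × ℂ // ‖p.1‖ ^ 2 + ‖p.2‖ ^ 2 = 1})

instance : CompactSpace SU2 := by
  refine isCompact_iff_compactSpace.1 (Metric.isCompact_of_isClosed_isBounded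
    (s := {p : ℂ × ℂ | ‖p.1‖ ^ 2 + ‖p.2‖ ^ 2 = 1}) ?_ ?_)
  · exact isClosed_eq (by fun_prop) continuous_const
  · refine (Metric.isBounded_iff_subset_closedBall (0 : ℂ × ℂ)).2 ⟨1, fun p hp => ?_⟩
    have hp' : ‖p.1‖ ^ 2 + ‖p.2‖ ^ 2 = 1 := hp
    rw [mem_closedBall_zero_iff, Prod.norm_def]
    exact max_le (by nlinarith [norm_nonneg p.1, sq_nonneg ‖p.2‖])
      (by nlinarith [norm_nonneg p.2, sq_nonneg ‖p.1‖])

/-- The continuous map `(a, c) ↦ (-a, c)`. -/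
def flipA : C(SU2, SU2) where
  toFun p := ⟨(-p.1.1, p.1.2), by rw [norm_neg]; exact p.2⟩
  continuous_toFun := by
    refine Continuous.subtype_mk (f := fun p : SU2 => ((-p.1.1, p.1.2) : ℂ × ℂ)) ?_ _
    exact (continuous_fst.comp continuous_subtype_val).neg.prodMk
      (continuous_snd.comp continuous_subtype_val)

/-- The continuous map `(a, c) ↦ (a, -c)`. -/
def flipC : C(SU2, SU2) where
  toFun p := ⟨(p.1.1, -p.1.2), by rw [norm_neg]; exact p.2⟩
  continuous_toFun := by
    refine Continuous.subtype_mk (f := fun p : SU2 => ((p.1.1, -p.1.2) : ℂ × ℂ)) ?_ _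
    exact (continuous_fst.comp continuous_subtype_val).prodMk
      (continuous_snd.comp continuous_subtype_val).neg

theorem flipA_flipA (p : SU2) : flipA (flipA p) = p :=
  Subtype.ext (Prod.ext (neg_neg p.1.1) rfl)

theorem flipC_flipC (p : SU2) : flipC (flipC p) = p :=
  Subtype.ext (Prod.ext rfl (neg_neg p.1.2))

/-- The coordinate function `α(a, c) = a` in `C(SU(2))`. -/
def α : C(SU2, ℂ) where
  toFun p := p.1.1
  continuous_toFun := continuous_fst.comp continuous_subtype_val

/-- The coordinate function `γ(a, c) = c` in `C(SU(2))`. -/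
def γ : C(SU2, ℂ) where
  toFun p := p.1.2
  continuous_toFun := continuous_snd.comp continuous_subtype_val

theorem conj_mul_add (p : SU2) :
    (starRingEnd ℂ) (α p) * α p + (starRingEnd ℂ) (γ p) * γ p = 1 := by
  have h : ‖p.1.1‖ ^ 2 + ‖p.1.2‖ ^ 2 = 1 := p.2
  change (starRingEnd ℂ) p.1.1 * p.1.1 + (starRingEnd ℂ) p.1.2 * p.1.2 = 1
  rw [Complex.conj_mul', Complex.conj_mul']
  exact_mod_cast h

end SU2

/-- The C⋆-algebra `M₂(C(SU(2)))`. -/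
abbrev M2CSU2 : Type := CStarMatrix (Fin 2) (Fin 2) C(SU2, ℂ)

namespace M2CSU2

instance : CStarAlgebra M2CSU2 := inferInstance

/-- The matrix with rows `(f, g)` and `(h, k)`. -/
def mk (f g h k : C(SU2, ℂ)) : M2CSU2 := CStarMatrix.ofMatrix !![f, g; h, k]

@[simp] theorem mk_00 (f g h k : C(SU2, ℂ)) : mk f g h k 0 0 = f := rfl
@[simp] theorem mk_01 (f g h k : C(SU2, ℂ)) : mk f g h k 0 1 = g := rfl
@[simp] theorem mk_10 (f g h k : C(SU2, ℂ)) : mk f g h k 1 0 = h := rfl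
@[simp] theorem mk_11 (f g h k : C(SU2, ℂ)) : mk f g h k 1 1 = k := rfl

theorem ext' {M N : M2CSU2} (h00 : M 0 0 = N 0 0) (h01 : M 0 1 = N 0 1) (h10 : M 1 0 = N 1 0)
    (h11 : M 1 1 = N 1 1) : M = N := by
  refine CStarMatrix.ext fun i j => ?_
  fin_cases i <;> fin_cases j <;> assumption

theorem mul_entry (M N : M2CSU2) (i j : Fin 2) :
    (M * N) i j = M i 0 * N 0 j + M i 1 * N 1 j := by
  rw [CStarMatrix.mul_apply, Fin.sum_univ_two]

/-- The automorphism `β₁`, sending the matrix with rows `(f, g)`, `(h, k)` to the matrix with rows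
`(f·s, -g·s)`, `(-h·s, k·s)`, where `(f·s)(a, c) = f (a, -c)`. -/
def β₁ : M2CSU2 ≃⋆ₐ[ℂ] M2CSU2 where
  toFun M := mk ((M 0 0).comp SU2.flipC) (-(M 0 1).comp SU2.flipC)
    (-(M 1 0).comp SU2.flipC) ((M 1 1).comp SU2.flipC)
  invFun M := mk ((M 0 0).comp SU2.flipC) (-(M 0 1).comp SU2.flipC)
    (-(M 1 0).comp SU2.flipC) ((M 1 1).comp SU2.flipC)
  left_inv M := by
    apply ext' <;> ext p <;> simp [SU2.flipC_flipC]
  right_inv M := by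
    apply ext' <;> ext p <;> simp [SU2.flipC_flipC]
  map_mul' M N := by
    apply ext' <;> ext p <;> simp [mul_entry] <;> ring
  map_add' M N := by
    apply ext' <;> ext p <;> simp [add_comm]
  map_star' M := by
    apply ext' <;> ext p <;> simp [CStarMatrix.star_apply]
  map_smul' z M := by
    apply ext' <;> ext p <;> simp

/-- The automorphism `β₂`, sending the matrix with rows `(f, g)`, `(h, k)` to the matrix with rows
`(k·r, h·r)`, `(g·r, f·r)`, where `(f·r)(a, c) = f (-a, c)`. -/
def β₂ : M2CSU2 ≃⋆ₐ[ℂ] M2CSU2 where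
  toFun M := mk ((M 1 1).comp SU2.flipA) ((M 1 0).comp SU2.flipA)
    ((M 0 1).comp SU2.flipA) ((M 0 0).comp SU2.flipA)
  invFun M := mk ((M 1 1).comp SU2.flipA) ((M 1 0).comp SU2.flipA)
    ((M 0 1).comp SU2.flipA) ((M 0 0).comp SU2.flipA)
  left_inv M := by
    apply ext' <;> ext p <;> simp [SU2.flipA_flipA]
  right_inv M := by
    apply ext' <;> ext p <;> simp [SU2.flipA_flipA]
  map_mul' M N := by
    apply ext' <;> ext p <;> simp [mul_entry, add_comm]
  map_add' M N := by
    apply ext' <;> ext p <;> simp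
  map_star' M := by
    apply ext' <;> ext p <;> simp [CStarMatrix.star_apply]
  map_smul' z M := by
    apply ext' <;> ext p <;> simp

theorem β₁_mul_β₁ : β₁ * β₁ = 1 := StarAlgEquiv.ext β₁.left_inv

theorem β₂_mul_β₂ : β₂ * β₂ = 1 := StarAlgEquiv.ext β₂.left_inv

theorem β₁_mul_β₂ : β₁ * β₂ = β₂ * β₁ := by
  refine StarAlgEquiv.ext fun M => ?_
  change β₁ (β₂ M) = β₂ (β₁ M)
  apply ext' <;> rfl

/-- The action `β` of `ℤ/2 ⊕ ℤ/2` on `M₂(C(SU(2)))` in which the two canonical generators act by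
`β₁` and `β₂`. -/
def β : Multiplicative (ZMod 2 × ZMod 2) →* (M2CSU2 ≃⋆ₐ[ℂ] M2CSU2) where
  toFun g := β₁ ^ (Multiplicative.toAdd g).1.val * β₂ ^ (Multiplicative.toAdd g).2.val
  map_one' := rfl
  map_mul' g h := by
    have h1 : β₁ ^ 2 = 1 := by rw [sq, β₁_mul_β₁]
    have h2 : β₂ ^ 2 = 1 := by rw [sq, β₂_mul_β₂]
    have hc : Commute β₁ β₂ := β₁_mul_β₂
    rw [toAdd_mul, Prod.fst_add, Prod.snd_add, ZMod.val_add, ZMod.val_add,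
      ← pow_eq_pow_mod _ h1, ← pow_eq_pow_mod _ h2, pow_add, pow_add]
    exact (hc.pow_pow _ _).symm.mul_mul_mul_comm _ _ |>.symm

end M2CSU2

/-- The fixed point algebra of an action of a group `G` on a ⋆-algebra `A` by ⋆-automorphisms. -/
def fixedPointAlgebra {G A : Type*} [Group G] [Ring A] [StarRing A] [Algebra ℂ A]
    [StarModule ℂ A] (σ : G →* (A ≃⋆ₐ[ℂ] A)) : StarSubalgebra ℂ A where
  carrier := {x | ∀ g, σ g x = x}
  mul_mem' hx hy g := by rw [map_mul, hx g, hy g]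
  add_mem' hx hy g := by rw [map_add, hx g, hy g]
  algebraMap_mem' z g := by
    rw [Algebra.algebraMap_eq_smul_one, map_smul, map_one]
  star_mem' hx g := by rw [map_star, hx g]

/-- The matrices `diag(α, -α)` and `offdiag(γ, γ)` satisfy the relations for `q = -1`. -/
theorem isSUqPair_M2CSU2 :
    IsSUqPair (-1) (M2CSU2.mk SU2.α 0 0 (-SU2.α)) (M2CSU2.mk 0 SU2.γ SU2.γ 0) := by
  refine ⟨?_, ?_, ?_, ?_, ?_⟩ <;> apply M2CSU2.ext' <;> ext p <;>
    simp [M2CSU2.mul_entry, CStarMatrix.star_apply] <;>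
    first
    | exact SU2.conj_mul_add p
    | exact mul_comm _ _
    | linear_combination SU2.conj_mul_add p

/-- The ⋆-homomorphism `φ : C(SU_{-1}(2)) → M₂(C(SU(2)))` given by the universal property. -/
def CSUq.φ : CSUq (-1) →⋆ₐ[ℂ] M2CSU2 := CSUq.lift isSUqPair_M2CSU2

end

/-! Injectivity comes from untwisting twice. At `q = 1` the relations force a commutative
C⋆-algebra, and Gelfand duality shows that `C(SU(2))` is universal for them
(`IsSUqPair.exists_starAlgHom`). Pairing the generators with the anticommuting Pauli matrices σ_z,
σ_x changes `q` into `-q` (`IsSUqPair.twist`), so the generators of `C(SU_{-1}(2))` yield ψ :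
C(SU(2)) → M₂(C(SU_{-1}(2))). Applying ψ to the entries of `φ` sends α to σ_z⊗σ_z⊗α and γ to
σ_x⊗σ_x⊗γ. Both σ_z⊗σ_z and σ_x⊗σ_x fix e₀⊗e₀ + e₁⊗e₁, so on this vector the composite acts as x
itself, and x is recovered from `φ x` (`CSUq.sum_apply_φ`).

For the image, a matrix fixed by β is determined by its first row, whose entries are even and odd
under c ↦ -c. Adding them identifies the fixed point algebra, as a vector space, with C(SU(2)); the
inverse is `ofParts`. It is not multiplicative, but it turns multiplication by α, γ and their
adjoints into left multiplication by `φ(α)`, `φ(γ)` and their adjoints, up to a flip a ↦ -a in the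
case of γ. Starting from 1 = `ofParts 1`, every ⋆-polynomial in α, γ is thus carried into the range
of `φ`. That range is closed because an injective ⋆-homomorphism is isometric, and Stone–Weierstrass
gives all of C(SU(2)). -/

/-! ### Stone–Weierstrass and the universal property of C(SU(2)) -/

theorem SU2.adjoin_dense :
    (StarAlgebra.adjoin ℂ {SU2.α, SU2.γ}).topologicalClosure = ⊤ := by
  refine ContinuousMap.starSubalgebra_topologicalClosure_eq_top_of_separatesPoints _ ?_
  intro x y hxy
  by_cases h : SU2.α x = SU2.α y
  · refine ⟨SU2.γ, ⟨SU2.γ, StarAlgebra.subset_adjoin ℂ _ (by simp), rfl⟩, fun h' => hxy ?_⟩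
    exact Subtype.ext (Prod.ext h h')
  · exact ⟨SU2.α, ⟨SU2.α, StarAlgebra.subset_adjoin ℂ _ (by simp), rfl⟩, h⟩

open scoped IsMulCommutative in
open WeakDual in
/-- The universal property of `C(SU(2)) = C(SU_1(2))`. -/
theorem IsSUqPair.exists_starAlgHom {B : Type*} [CStarAlgebra B] {a c : B}
    (h : IsSUqPair 1 a c) : ∃ ψ : C(SU2, ℂ) →⋆ₐ[ℂ] B, ψ SU2.α = a ∧ ψ SU2.γ = c := by
  have hac : a * c = c * a := by simpa using h.a_mul_c
  have hac' : a * star c = star c * a := by simpa using h.a_mul_star_c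
  have hc := h.c_mul_star_c
  have hca' : c * star a = star a * c := by simpa [eq_comm] using congrArg star hac'
  -- Normality of `a` is not among the relations: at `q = 1`, with `c` normal, the two unit
  -- relations differ only in `a * star a` versus `star a * a`.
  have ha : a * star a = star a * a := by
    have h1 := h.a_mul_star_a
    have h2 := h.star_a_mul_a
    simp only [Complex.ofReal_one, one_pow, one_smul, hc] at h1
    exact add_right_cancel (h1.trans h2.symm)
  let S : StarSubalgebra ℂ B := (StarAlgebra.adjoin ℂ {a, c}).topologicalClosure
  have hS : IsClosed (S : Set B) := StarSubalgebra.isClosed_topologicalClosure _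
  have : IsMulCommutative (StarAlgebra.adjoin ℂ {a, c}) :=
    StarAlgebra.isMulCommutative_adjoin ℂ (by rintro x (rfl | rfl) y (rfl | rfl) <;> simp [hac])
      (by rintro x (rfl | rfl) y (rfl | rfl) <;> assumption)
  let _ : CommRing S := (StarAlgebra.adjoin ℂ {a, c}).commRingTopologicalClosure mul_comm
  let _ : CommCStarAlgebra S := { }
  have mem : ∀ x ∈ ({a, c} : Set B), x ∈ S := fun x hx =>
    StarSubalgebra.le_topologicalClosure _ (StarAlgebra.subset_adjoin ℂ _ hx)
  let a' : S := ⟨a, mem a (by simp)⟩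
  let c' : S := ⟨c, mem c (by simp)⟩
  have hrel : star a' * a' + star c' * c' = 1 := Subtype.ext h.star_a_mul_a
  have sphere (χ : characterSpace ℂ S) : ‖χ a'‖ ^ 2 + ‖χ c'‖ ^ 2 = 1 := by
    have h1 := congrArg χ hrel
    simp only [map_add, map_mul, map_star, map_one, RCLike.star_def, Complex.conj_mul'] at h1
    exact_mod_cast h1
  -- The spectrum of `S` maps to SU(2) by its joint values on `a`, `c`. Pulling functions back along
  -- `X` and inverting the Gelfand transform gives the homomorphism.
  let X : C(characterSpace ℂ S, SU2) :=
    { toFun := fun χ => ⟨(χ a', χ c'), sphere χ⟩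
      continuous_toFun := Continuous.subtype_mk
        ((gelfandTransform ℂ S a').continuous.prodMk (gelfandTransform ℂ S c').continuous)
        sphere }
  refine ⟨(S.subtype.comp ((gelfandStarTransform S).symm : _ →⋆ₐ[ℂ] S)).comp
    (ContinuousMap.compStarAlgHom' ℂ ℂ X), ?_, ?_⟩
  · have : SU2.α.comp X = gelfandStarTransform S a' := by ext χ; rfl
    change ((gelfandStarTransform S).symm (SU2.α.comp X) : B) = a
    rw [this, StarAlgEquiv.symm_apply_apply]
  · have : SU2.γ.comp X = gelfandStarTransform S c' := by ext χ; rfl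
    change ((gelfandStarTransform S).symm (SU2.γ.comp X) : B) = c
    rw [this, StarAlgEquiv.symm_apply_apply]

/-- Tensoring with Pauli matrices exchanges the relations for `q` and for `-q`. -/
theorem IsSUqPair.twist {q : ℝ} {A : Type*} [CStarAlgebra A] {a c : A} (h : IsSUqPair q a c) :
    IsSUqPair (-q) (CStarMatrix.ofMatrix !![a, 0; 0, -a]) (CStarMatrix.ofMatrix !![0, c; c, 0]) := by
  -- The simplification below rewrites `c * star c` to `star c * c`, so this relation is needed in
  -- that form.
  have h' : a * star a + (q : ℂ) ^ 2 • (star c * c) = 1 := by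
    rw [← h.c_mul_star_c, h.a_mul_star_a]
  refine ⟨?_, ?_, ?_, ?_, ?_⟩ <;> refine CStarMatrix.ext fun i j => ?_ <;>
    fin_cases i <;> fin_cases j <;>
    simp [CStarMatrix.mul_apply, CStarMatrix.star_apply, Fin.sum_univ_two,
      h.star_a_mul_a, h', h.a_mul_c, h.a_mul_star_c, h.c_mul_star_c]

/-! ### Injectivity of φ by untwisting -/

section Injective

open scoped CStarAlgebra

theorem CStarMatrix.continuous_entry {m n A : Type*} [NonUnitalCStarAlgebra A] (i : m) (j : n) :
    Continuous fun M : CStarMatrix m n A => M i j :=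
  continuous_apply_apply (ρ := fun _ _ => A) i j

theorem CSUq.φ_α : CSUq.φ (CSUq.α (-1)) = M2CSU2.mk SU2.α 0 0 (-SU2.α) := CSUq.lift_α _

theorem CSUq.φ_γ : CSUq.φ (CSUq.γ (-1)) = M2CSU2.mk 0 SU2.γ SU2.γ 0 := CSUq.lift_γ _

/-- The Pauli twist of `φ` fixes the vector `e₀ ⊗ e₀ + e₁ ⊗ e₁`, up to coefficients in
`C(SU_{-1}(2))`. -/
theorem CSUq.sum_apply_φ
    (ψ : C(SU2, ℂ) →⋆ₐ[ℂ] CStarMatrix (Fin 2) (Fin 2) (CSUq (-1)))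
    (hα : ψ SU2.α = CStarMatrix.ofMatrix !![CSUq.α (-1), 0; 0, -CSUq.α (-1)])
    (hγ : ψ SU2.γ = CStarMatrix.ofMatrix !![0, CSUq.γ (-1); CSUq.γ (-1), 0])
    (x : CSUq (-1)) (i k : Fin 2) :
    ∑ j, ψ (CSUq.φ x i j) k j = if i = k then x else 0 := by
  -- The C⋆-norm on matrices over an algebra uses an order on the coefficients; the spectral order
  -- supplies it.
  let := CStarAlgebra.spectralOrder (CSUq (-1))
  let := CStarAlgebra.spectralOrderedRing (CSUq (-1))
  have hφ : Continuous CSUq.φ := map_continuous CSUq.φ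
  have hψ : Continuous ψ := map_continuous ψ
  refine (CSUq.denseRange_ofFree (-1)).induction_on
    (p := fun x => ∑ j, ψ (CSUq.φ x i j) k j = if i = k then x else 0) x ?_ fun y => ?_
  · refine isClosed_eq (continuous_finsetSum _ fun j _ => ?_) (by split_ifs <;> fun_prop)
    exact (CStarMatrix.continuous_entry k j).comp
      (hψ.comp ((CStarMatrix.continuous_entry i j).comp hφ))
  · induction y using FreeStarAlgebra.induction generalizing i k with
    | h_scalar z =>
      rw [AlgHomClass.commutes, AlgHomClass.commutes, Algebra.algebraMap_eq_smul_one,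
        Algebra.algebraMap_eq_smul_one]
      fin_cases i <;> fin_cases k <;> simp [CStarMatrix.one_apply, Fin.sum_univ_two]
    | h_letter s =>
      have hl : ∀ l : Fin 2, (FreeStarAlgebra.letter (Sum.inr l) : SUq.Free) =
          star (FreeStarAlgebra.gen l) := fun l => (FreeStarAlgebra.star_letter (Sum.inl l)).symm
      have h0 : ofFree (-1) (FreeStarAlgebra.gen 0) = α (-1) := rfl
      have h1 : ofFree (-1) (FreeStarAlgebra.gen 1) = γ (-1) := rfl
      have hl' : ∀ l : Fin 2, (FreeStarAlgebra.letter (Sum.inl l) : SUq.Free) =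
          FreeStarAlgebra.gen l := fun l => rfl
      -- This is the invariance of the vector under σ_z⊗σ_z and σ_x⊗σ_x. The adjoint letters behave
      -- alike since Pauli matrices are self-adjoint.
      rcases s with l | l <;> fin_cases l <;> fin_cases i <;> fin_cases k <;>
        simp [Fin.sum_univ_two, hl, hl', h0, h1, φ_α, φ_γ, hα, hγ, CStarMatrix.star_apply, map_star]
    | h_mul x y hx hy =>
      rw [map_mul]
      generalize ofFree (-1) x = a at hx ⊢
      generalize ofFree (-1) y = b at hy ⊢
      -- The operator of `b` acts on the vector first and returns it with coefficient `b`, leaving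
      -- only the terms `l = m`; hence the induction needs all `i`, `k` at once.
      calc ∑ j, ψ (φ (a * b) i j) k j
          = ∑ l, ∑ m, ψ (φ a i l) k m * ∑ j, ψ (φ b l j) m j := by
            simp only [map_mul, CStarMatrix.mul_apply, map_add, Fin.sum_univ_two,
              CStarMatrix.add_apply, mul_add]
            abel
        _ = (∑ l, ψ (φ a i l) k l) * b := by
            simp only [hy, mul_ite, mul_zero, Finset.sum_ite_eq, Finset.mem_univ, if_true,
              Finset.sum_mul]
        _ = if i = k then a * b else 0 := by
            rw [hx, ite_mul, zero_mul]
    | h_add x y hx hy =>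
      simp only [map_add, CStarMatrix.add_apply, Finset.sum_add_distrib, hx, hy]
      split_ifs <;> simp

/-- The coordinate `i = k = 0` of `CSUq.sum_apply_φ` expresses `x` through the entries of `φ x`. -/
theorem CSUq.φ_injective : Function.Injective CSUq.φ := by
  have h : IsSUqPair 1 (CStarMatrix.ofMatrix !![CSUq.α (-1), 0; 0, -CSUq.α (-1)])
      (CStarMatrix.ofMatrix !![0, CSUq.γ (-1); CSUq.γ (-1), 0]) := by
    simpa using (CSUq.isSUqPair (-1)).twist
  let := CStarAlgebra.spectralOrder (CSUq (-1))
  let := CStarAlgebra.spectralOrderedRing (CSUq (-1))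
  obtain ⟨ψ, hα, hγ⟩ := IsSUqPair.exists_starAlgHom
    (B := CStarMatrix (Fin 2) (Fin 2) (CSUq (-1))) h
  refine (injective_iff_map_eq_zero _).2 fun x hx => ?_
  simpa [hx] using (CSUq.sum_apply_φ ψ hα hγ x 0 0).symm

/-- An injective ⋆-homomorphism of C⋆-algebras is isometric, so its image is complete. This permits
the passage from polynomials to limits. -/
theorem CSUq.isClosed_range_φ : IsClosed (Set.range CSUq.φ) :=
  (NonUnitalStarAlgHom.isometry CSUq.φ CSUq.φ_injective).isClosedEmbedding.isClosed_range

end Injective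

/-! ### The range of φ is fixed by β -/

namespace SU2

@[simp] theorem α_flipA (p : SU2) : α (flipA p) = -α p := rfl

@[simp] theorem α_flipC (p : SU2) : α (flipC p) = α p := rfl

@[simp] theorem γ_flipA (p : SU2) : γ (flipA p) = γ p := rfl

@[simp] theorem γ_flipC (p : SU2) : γ (flipC p) = -γ p := rfl

theorem flipC_flipA (p : SU2) : flipC (flipA p) = flipA (flipC p) := rfl

end SU2

theorem mem_fixedPointAlgebra_β {x : M2CSU2} :
    x ∈ fixedPointAlgebra M2CSU2.β ↔ M2CSU2.β₁ x = x ∧ M2CSU2.β₂ x = x := by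
  refine ⟨fun h => ⟨h (Multiplicative.ofAdd (1, 0)), h (Multiplicative.ofAdd (0, 1))⟩,
    fun h g => ?_⟩
  have key : ∀ (b : M2CSU2 ≃⋆ₐ[ℂ] M2CSU2), b x = x → ∀ n : ℕ, (b ^ n) x = x := by
    intro b hb n
    induction n with
    | zero => rfl
    | succ n ih => rw [pow_succ]; change (b ^ n) (b x) = x; rw [hb, ih]
  change (M2CSU2.β₁ ^ _) ((M2CSU2.β₂ ^ _) x) = x
  rw [key _ h.2, key _ h.1]

/-- Uniqueness in the universal property: `b ∘ φ` and `φ` agree on the generators. -/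
theorem CSUq.β_φ (b : M2CSU2 ≃⋆ₐ[ℂ] M2CSU2)
    (hα : b (M2CSU2.mk SU2.α 0 0 (-SU2.α)) = M2CSU2.mk SU2.α 0 0 (-SU2.α))
    (hγ : b (M2CSU2.mk 0 SU2.γ SU2.γ 0) = M2CSU2.mk 0 SU2.γ SU2.γ 0) (x : CSUq (-1)) :
    b (CSUq.φ x) = CSUq.φ x := by
  refine DFunLike.congr_fun (CSUq.hom_ext (φ := (b : M2CSU2 →⋆ₐ[ℂ] M2CSU2).comp CSUq.φ)
    (ψ := CSUq.φ) ?_ ?_) x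
  · change b (CSUq.φ (CSUq.α (-1))) = _
    rw [CSUq.φ_α, hα]
  · change b (CSUq.φ (CSUq.γ (-1))) = _
    rw [CSUq.φ_γ, hγ]

theorem CSUq.φ_mem_fixedPointAlgebra (x : CSUq (-1)) :
    CSUq.φ x ∈ fixedPointAlgebra M2CSU2.β := by
  rw [mem_fixedPointAlgebra_β]
  constructor <;> apply CSUq.β_φ <;> apply M2CSU2.ext' <;> ext p <;>
    simp [M2CSU2.β₁, M2CSU2.β₂]

/-! ### Every fixed matrix lies in the range of φ -/

namespace M2CSU2

/-- The matrix fixed by `β` whose first row consists of the even and the odd part of a function with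
respect to `(a, c) ↦ (a, -c)`. -/
noncomputable def ofParts : C(SU2, ℂ) →ₗ[ℂ] M2CSU2 where
  toFun f := mk ((1 / 2 : ℂ) • (f + f.comp SU2.flipC)) ((1 / 2 : ℂ) • (f - f.comp SU2.flipC))
    -- Invariance under `β₂` forces the second row: the first row in reverse order, flipped by a ↦
    -- -a.
    (((1 / 2 : ℂ) • (f - f.comp SU2.flipC)).comp SU2.flipA)
    (((1 / 2 : ℂ) • (f + f.comp SU2.flipC)).comp SU2.flipA)
  map_add' f g := by apply ext' <;> ext p <;> simp <;> ring
  map_smul' z f := by apply ext' <;> ext p <;> simp <;> ring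

theorem continuous_ofParts : Continuous ofParts := by
  have hC := ContinuousMap.continuous_precomp (Y := SU2) (Z := ℂ) SU2.flipC
  have hA := ContinuousMap.continuous_precomp (Y := SU2) (Z := ℂ) SU2.flipA
  have he := (continuous_id.add hC).const_smul (1 / 2 : ℂ)
  have ho := (continuous_id.sub hC).const_smul (1 / 2 : ℂ)
  refine continuous_pi fun i => continuous_pi fun j => ?_
  fin_cases i <;> fin_cases j
  exacts [he, ho, hA.comp ho, hA.comp he]

/-- `β₁` makes `x 0 0` even and `x 0 1` odd in c, so they are the two parts of their sum; `β₂`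
determines the second row. -/
theorem ofParts_eq {x : M2CSU2} (h₁ : β₁ x = x) (h₂ : β₂ x = x) :
    ofParts (x 0 0 + x 0 1) = x := by
  have e (p : SU2) : x 0 0 (SU2.flipC p) = x 0 0 p := congrArg (fun y : M2CSU2 => y 0 0 p) h₁
  have o (p : SU2) : -x 0 1 (SU2.flipC p) = x 0 1 p := congrArg (fun y : M2CSU2 => y 0 1 p) h₁
  have o' (p : SU2) : x 0 1 (SU2.flipC p) = -x 0 1 p := neg_eq_iff_eq_neg.1 (o p)
  have a (p : SU2) : x 0 1 (SU2.flipA p) = x 1 0 p := congrArg (fun y : M2CSU2 => y 1 0 p) h₂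
  have b (p : SU2) : x 0 0 (SU2.flipA p) = x 1 1 p := congrArg (fun y : M2CSU2 => y 1 1 p) h₂
  apply ext' <;> ext p <;> simp [ofParts, ← a, ← b, o', e] <;> ring

/-- α is even in c, so it respects the two parts; the sign in the second row is that of α under a ↦
-a. -/
theorem ofParts_α_mul (f : C(SU2, ℂ)) :
    ofParts (SU2.α * f) = mk SU2.α 0 0 (-SU2.α) * ofParts f := by
  apply ext' <;> ext p <;> simp [ofParts, mul_entry, SU2.flipC_flipA] <;> ring

theorem ofParts_star_α_mul (f : C(SU2, ℂ)) :
    ofParts (star SU2.α * f) = star (mk SU2.α 0 0 (-SU2.α)) * ofParts f := by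
  apply ext' <;> ext p <;> simp [ofParts, mul_entry, SU2.flipC_flipA,
    CStarMatrix.star_apply] <;> ring

/-- γ is odd in c and exchanges the two parts, as the off-diagonal matrix exchanges the rows. The
rows differ by a ↦ -a, which the flip of `f` compensates. -/
theorem ofParts_γ_mul (f : C(SU2, ℂ)) :
    ofParts (SU2.γ * f) = mk 0 SU2.γ SU2.γ 0 * ofParts (f.comp SU2.flipA) := by
  apply ext' <;> ext p <;> simp [ofParts, mul_entry, SU2.flipC_flipA, SU2.flipA_flipA] <;> ring

theorem ofParts_star_γ_mul (f : C(SU2, ℂ)) :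
    ofParts (star SU2.γ * f) = star (mk 0 SU2.γ SU2.γ 0) * ofParts (f.comp SU2.flipA) := by
  apply ext' <;> ext p <;> simp [ofParts, mul_entry, SU2.flipC_flipA, SU2.flipA_flipA,
    CStarMatrix.star_apply] <;> ring

theorem ofParts_mem_range_φ (f : C(SU2, ℂ)) : ofParts f ∈ CSUq.φ.range := by
  have hα : mk SU2.α 0 0 (-SU2.α) ∈ CSUq.φ.range := ⟨_, CSUq.φ_α⟩
  have hγ : mk 0 SU2.γ SU2.γ 0 ∈ CSUq.φ.range := ⟨_, CSUq.φ_γ⟩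
  -- Multiplication by γ trades `f` for its flip, so only a condition on both is stable under the
  -- generators.
  let W : Submodule ℂ C(SU2, ℂ) :=
    { carrier := {f | ofParts f ∈ CSUq.φ.range ∧ ofParts (f.comp SU2.flipA) ∈ CSUq.φ.range}
      add_mem' := fun {f g} hf hg => by
        have : (f + g).comp SU2.flipA = f.comp SU2.flipA + g.comp SU2.flipA := rfl
        refine ⟨?_, ?_⟩
        · rw [map_add]; exact add_mem hf.1 hg.1
        · rw [this, map_add]; exact add_mem hf.2 hg.2
      zero_mem' := by
        have : (0 : C(SU2, ℂ)).comp SU2.flipA = 0 := rfl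
        simp [this, zero_mem]
      smul_mem' := fun z f hf => by
        have : (z • f).comp SU2.flipA = z • f.comp SU2.flipA := rfl
        refine ⟨?_, ?_⟩
        · rw [map_smul]; exact SMulMemClass.smul_mem z hf.1
        · rw [this, map_smul]; exact SMulMemClass.smul_mem z hf.2 }
  have hW : IsClosed (W : Set C(SU2, ℂ)) := by
    have hr : IsClosed (CSUq.φ.range : Set M2CSU2) := CSUq.isClosed_range_φ
    exact (hr.preimage continuous_ofParts).inter
      (hr.preimage (continuous_ofParts.comp (ContinuousMap.continuous_precomp SU2.flipA)))
  have hone : (1 : C(SU2, ℂ)) ∈ W := by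
    have h1 : ofParts 1 = 1 := by
      apply ext' <;> ext p <;> simp [ofParts] <;> norm_num
    have h2 : (1 : C(SU2, ℂ)).comp SU2.flipA = 1 := rfl
    change _ ∧ _
    rw [h2, h1]
    exact ⟨one_mem _, one_mem _⟩
  have hgen : ∀ g ∈ ({SU2.α, SU2.γ} : Set C(SU2, ℂ)) ∪ star {SU2.α, SU2.γ},
      ∀ f ∈ W, g * f ∈ W := by
    have hA (f : C(SU2, ℂ)) : (SU2.α * f).comp SU2.flipA = -(SU2.α * f.comp SU2.flipA) := by
      ext p; simp
    have hA' (f : C(SU2, ℂ)) :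
        (star SU2.α * f).comp SU2.flipA = -(star SU2.α * f.comp SU2.flipA) := by
      ext p; simp
    have hG (f : C(SU2, ℂ)) : (SU2.γ * f).comp SU2.flipA = SU2.γ * f.comp SU2.flipA := rfl
    have hG' (f : C(SU2, ℂ)) :
        (star SU2.γ * f).comp SU2.flipA = star SU2.γ * f.comp SU2.flipA := rfl
    have hAA (f : C(SU2, ℂ)) : (f.comp SU2.flipA).comp SU2.flipA = f := by
      ext p; simp [SU2.flipA_flipA]
    intro g hg f hf
    have hg' : g = SU2.α ∨ g = SU2.γ ∨ g = star SU2.α ∨ g = star SU2.γ := by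
      simpa [or_assoc, ← star_eq_iff_star_eq, eq_comm (b := star _)] using hg
    rcases hg' with rfl | rfl | rfl | rfl <;> refine ⟨?_, ?_⟩
    · rw [ofParts_α_mul]; exact mul_mem hα hf.1
    · rw [hA, map_neg, ofParts_α_mul]; exact neg_mem (mul_mem hα hf.2)
    · rw [ofParts_γ_mul]; exact mul_mem hγ hf.2
    · rw [hG, ofParts_γ_mul, hAA]; exact mul_mem hγ hf.1
    · rw [ofParts_star_α_mul]; exact mul_mem (star_mem hα) hf.1
    · rw [hA', map_neg, ofParts_star_α_mul]; exact neg_mem (mul_mem (star_mem hα) hf.2)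
    · rw [ofParts_star_γ_mul]; exact mul_mem (star_mem hγ) hf.2
    · rw [hG', ofParts_star_γ_mul, hAA]; exact mul_mem (star_mem hγ) hf.1
  -- `W` is not known to be closed under products, so the induction runs over multipliers `g`
  -- preserving `W`; applying them to 1 puts the polynomials in `W`.
  have hadjoin : ∀ g ∈ StarAlgebra.adjoin ℂ {SU2.α, SU2.γ}, ∀ f ∈ W, g * f ∈ W := by
    intro g hg
    change g ∈ Algebra.adjoin ℂ _ at hg
    induction hg using Algebra.adjoin_induction with
    | mem g hg => exact hgen g hg
    | algebraMap z =>
      intro f hf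
      rw [← Algebra.smul_def]
      exact W.smul_mem z hf
    | add g h _ _ hg hh =>
      intro f hf
      rw [add_mul]
      exact W.add_mem (hg f hf) (hh f hf)
    | mul g h _ _ hg hh =>
      intro f hf
      rw [mul_assoc]
      exact hg _ (hh f hf)
  have hf : f ∈ (StarAlgebra.adjoin ℂ {SU2.α, SU2.γ}).topologicalClosure := by
    rw [SU2.adjoin_dense]; trivial
  have hsub : (StarAlgebra.adjoin ℂ {SU2.α, SU2.γ} : Set C(SU2, ℂ)) ⊆ W := fun g hg => by
    simpa using hadjoin g hg 1 hone
  exact (closure_minimal hsub hW hf).1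

theorem orderOf_β₁ : orderOf β₁ = 2 := by
  refine orderOf_eq_prime (by rw [sq, β₁_mul_β₁]) fun h => ?_
  -- The constant matrix unit e₀₁ changes sign under `β₁`, which is visible at any point of SU(2).
  have h1 : β₁ (mk 0 1 0 0) = mk 0 1 0 0 := by rw [h]; rfl
  have h2 : (-1 : ℂ) = 1 :=
    congrArg (fun y : M2CSU2 => y 0 1 ⟨(1, 0), by simp⟩) h1
  norm_num at h2

theorem orderOf_β₂ : orderOf β₂ = 2 := by
  refine orderOf_eq_prime (by rw [sq, β₂_mul_β₂]) fun h => ?_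
  have h1 : β₂ (mk 1 0 0 0) = mk 1 0 0 0 := by rw [h]; rfl
  have h2 : (0 : ℂ) = 1 :=
    congrArg (fun y : M2CSU2 => y 0 0 ⟨(1, 0), by simp⟩) h1
  norm_num at h2

end M2CSU2

theorem theorem1p5 :
    CSUq.φ (CSUq.α (-1)) = M2CSU2.mk SU2.α 0 0 (-SU2.α) ∧
    CSUq.φ (CSUq.γ (-1)) = M2CSU2.mk 0 SU2.γ SU2.γ 0 ∧
    Function.Injective CSUq.φ ∧
    Commute M2CSU2.β₁ M2CSU2.β₂ ∧ orderOf M2CSU2.β₁ = 2 ∧ orderOf M2CSU2.β₂ = 2 ∧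
    M2CSU2.β (Multiplicative.ofAdd (1, 0)) = M2CSU2.β₁ ∧
    M2CSU2.β (Multiplicative.ofAdd (0, 1)) = M2CSU2.β₂ ∧
    CSUq.φ.range = fixedPointAlgebra M2CSU2.β := by
  refine ⟨CSUq.φ_α, CSUq.φ_γ, CSUq.φ_injective, M2CSU2.β₁_mul_β₂, M2CSU2.orderOf_β₁,
    M2CSU2.orderOf_β₂, rfl, rfl, le_antisymm ?_ fun x hx => ?_⟩
  · rintro _ ⟨x, rfl⟩
    exact CSUq.φ_mem_fixedPointAlgebra x
  · obtain ⟨h₁, h₂⟩ := mem_fixedPointAlgebra_β.1 hx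
    rw [← M2CSU2.ofParts_eq h₁ h₂]
    exact M2CSU2.ofParts_mem_range_φ _
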